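/- Let $K$ agents and a server perform inference over a finite hypothesis set $\Theta$ with true hypothesis $\theta^\circ\in\Theta$. Agent $k$ has likelihood models $L_k(\cdot\mid\theta)$, $\theta\in\Theta$, which are probability densities with respect to a common $\sigma$-finite reference measure on its observation space. At each time $i=1,2,\dots$ agent $k$ receives an observation $\boldsymbol\xi_{k,i}$ with density $L_k(\cdot\mid\theta^\circ)$; the joint observations $(\boldsymbol\xi_{1,i},\dots,\boldsymbol\xi_{K,i})$ are i.i.d. over $i$, and the dependence across agents is arbitrary. Let $\pi_1,\dots,\pi_K>0$ with $\sum_k\pi_k=1$, let $\mu_0$ be a deterministic probability vector on $\Theta$, and define the beliefs under arithmetic averaging by $$\boldsymbol\psi_{k,i}(\theta)=\frac{L_k(\boldsymbol\xi_{k,i}\mid\theta)\,\boldsymbol\mu_{i-1}(\theta)}{\sum_{\theta'\in\Theta}L_k(\boldsymbol\xi_{k,i}\mid\theta')\,\boldsymbol\mu_{i-1}(\theta')},\qquad \boldsymbol\mu_i(\theta)=\sum_{k=1}^K\pi_k\boldsymbol\psi_{k,i}(\theta),\qquad \boldsymbol\mu_0=\mu_0 .$$ Assume that $D_{\mathrm{KL}}(L_k(\cdot\mid\theta^\circ)\,\|\,L_k(\cdot\mid\theta'))<\infty$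 for all $k$ and $\theta'\in\Theta$, and that for each $\theta'\ne\theta^\circ$ there is an agent $k$ with $D_{\mathrm{KL}}(L_k(\cdot\mid\theta^\circ)\,\|\,L_k(\cdot\mid\theta'))>0$. Let $\theta\neq\theta^\circ$ with $\mu_0(\theta)>0$ and $\mu_0(\theta^\circ)>0$, and put $$\rho_A=-\mathbb E\Big[\log\sum_{k}\pi_k\boldsymbol r_{k,i}\Big],\qquad \sigma_A^2=\mathrm{Var}\Big[\log\sum_{k}\pi_k\boldsymbol r_{k,i}\Big],\qquad \boldsymbol r_{k,i}=\frac{L_k(\boldsymbol\xi_{k,i}\mid\theta)}{L_k(\boldsymbol\xi_{k,i}\mid\theta^\circ)},$$ which do not depend on $i$. If $0<\sigma_A^2<\infty$, then the log-belief ratio $\boldsymbol\lambda_i(\theta)=\log\frac{\boldsymbol\mu_i(\theta^\circ)}{\boldsymbol\mu_i(\theta)}$ satisfies, for every $t\in\mathbb R$, $$\lim_{i\to\infty}\Pr\Big(\frac{\boldsymbol\lambda_i(\theta)-\rho_A\, i}{\sigma_A\sqrt i}\le t\Big)=\Phi(t),$$ where $\Phi$ is the standard Gaussian cumulative distribution function.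 -/

import Mathlib

open MeasureTheory ProbabilityTheory Filter Topology

noncomputable section

namespace FederatedAA

/-- The probability law on `X` whose density with respect to the reference measure `ν` is `f`. -/
def law {X : Type*} [MeasurableSpace X] (ν : Measure X) (f : X → ℝ) : Measure X :=
  ν.withDensity (fun x => ENNReal.ofReal (f x))

/-- Local Bayesian update: `ψ(θ) ∝ ℓ(θ) μ(θ)`, normalized to have total mass one. -/
def adapt {Θ : Type*} [Fintype Θ] (ℓ μ : Θ → ℝ) (θ : Θ) : ℝ :=
  ℓ θ * μ θ / ∑ θ', ℓ θ' * μ θ'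

/-- Arithmetic averaging of the beliefs `ψ k` with confidence weights `w k`. -/
def fuse {κ Θ : Type*} [Fintype κ] (w : κ → ℝ) (ψ : κ → Θ → ℝ) (θ : Θ) : ℝ :=
  ∑ k, w k * ψ k θ

/-- The belief `μ_i` of the server at time `i`, started at `μ₀`, along the data sequence `x`.
Time is counted from `0`, and `x i k` is the observation of agent `k` at time `i + 1`. -/
def belief {κ Θ : Type*} [Fintype κ] [Fintype Θ] {X : κ → Type*}
    (L : (k : κ) → Θ → X k → ℝ) (w : κ → ℝ) (μ₀ : Θ → ℝ) (x : ℕ → (k : κ) → X k) :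
    ℕ → Θ → ℝ
  | 0 => μ₀
  | i + 1 => fuse w (fun k => adapt (fun θ => L k θ (x i k)) (belief L w μ₀ x i))

/-- The log-belief ratio `log (μ_i(θ₀) / μ_i(θ))`. -/
def logBeliefRatio {κ Θ : Type*} [Fintype κ] [Fintype Θ] {X : κ → Type*}
    (L : (k : κ) → Θ → X k → ℝ) (w : κ → ℝ) (μ₀ : Θ → ℝ) (θ₀ θ : Θ)
    (x : ℕ → (k : κ) → X k) (i : ℕ) : ℝ :=
  Real.log (belief L w μ₀ x i θ₀ / belief L w μ₀ x i θ)

/-- `log (∑ k, w k * r k)` with the likelihood ratios `r k = L_k(y_k | θ) / L_k(y_k | θ₀)`,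
as a function of the joint observation `y` of all the agents at one time instant. -/
def logAvgRatio {κ Θ : Type*} [Fintype κ] {X : κ → Type*}
    (L : (k : κ) → Θ → X k → ℝ) (w : κ → ℝ) (θ₀ θ : Θ) (y : (k : κ) → X k) : ℝ :=
  Real.log (∑ k, w k * (L k θ (y k) / L k θ₀ (y k)))

/-- `ρ_A = - E[log (∑ k, w k * r k)]`, where `Y` is the joint observation at one time instant. -/
def rhoA {κ Θ Ω : Type*} [Fintype κ] [MeasurableSpace Ω] {X : κ → Type*}
    (P : Measure Ω) (L : (k : κ) → Θ → X k → ℝ) (w : κ → ℝ) (θ₀ θ : Θ)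
    (Y : Ω → (k : κ) → X k) : ℝ :=
  - ∫ ω, logAvgRatio L w θ₀ θ (Y ω) ∂P

/-- `σ_A²`, the variance of `log (∑ k, w k * r k)`, as an extended nonnegative number. -/
def sigmaSqA {κ Θ Ω : Type*} [Fintype κ] [MeasurableSpace Ω] {X : κ → Type*}
    (P : Measure Ω) (L : (k : κ) → Θ → X k → ℝ) (w : κ → ℝ) (θ₀ θ : Θ)
    (Y : Ω → (k : κ) → X k) : ENNReal :=
  evariance (fun ω => logAvgRatio L w θ₀ θ (Y ω)) P

/-- `σ_A`, the standard deviation of `log (∑ k, w k * r k)`. -/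
def sigmaA {κ Θ Ω : Type*} [Fintype κ] [MeasurableSpace Ω] {X : κ → Type*}
    (P : Measure Ω) (L : (k : κ) → Θ → X k → ℝ) (w : κ → ℝ) (θ₀ θ : Θ)
    (Y : Ω → (k : κ) → X k) : ℝ :=
  Real.sqrt (sigmaSqA P L w θ₀ θ Y).toReal

end FederatedAA

end

namespace FederatedAA

/-! ### Elementary inequalities -/

/-! Dividing numerator and denominator of the update by the density under `θ₀` multiplies `μ_i(θ)`
by `∑ k, w k * r k / e k`, where `e k` is the `evidenceRatio`. If every `e k` were 1, the log-belief
ratio would be minus an i.i.d. sum and the classical CLT would apply. In general each step adds an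
error of at most `2 * ∑ k, |log (e k)|`, so it suffices that these errors sum to `o(√n)` almost
surely.

For the true hypothesis `r k = 1`, and Jensen gives `log μ_n(θ₀) ≥ log μ₀(θ₀) - ∑ i, ∑ k, w k * log
(e k)`, while `μ_n(θ₀) ≤ 1`. Since the mean of `e k` is at most 1, the expected total of the
nonnegative gaps `e k - 1 - log (e k)` is at most `-log μ₀(θ₀)`
(`ae_summable_logGap_evidenceRatio`). The gaps are thus almost surely summable. As `|log e|` is at
most the gap plus twice its root, Cauchy–Schwarz yields `o(√n)`
(`tendsto_logBeliefRatio_add_sum_div_sqrt`), and Slutsky's theorem concludes. -/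

/-- The excess `x - 1 - log x`, which is nonnegative for `x > 0`. -/
noncomputable def logGap (x : ℝ) : ℝ := x - 1 - Real.log x

lemma logGap_nonneg {x : ℝ} (hx : 0 < x) : 0 ≤ logGap x := by
  have := Real.log_le_sub_one_of_pos hx
  unfold logGap
  linarith

/-- From `log x = 2 * log √x ≤ 2 * (√x - 1)` one gets `(√x - 1)^2 ≤ logGap x`. The root term is
needed because the gap is quadratic near 1. -/
lemma abs_log_le_logGap {x : ℝ} (hx : 0 < x) :
    |Real.log x| ≤ logGap x + 2 * √(logGap x) := by
  have hs : 0 < √x := Real.sqrt_pos.2 hx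
  have hlog : Real.log x = 2 * Real.log √x := by rw [Real.log_sqrt hx.le]; ring
  have hsq : √x ^ 2 = x := Real.sq_sqrt hx.le
  have h1 := Real.log_le_sub_one_of_pos hs
  have hg : (√x - 1) ^ 2 ≤ logGap x := by
    unfold logGap
    nlinarith
  have h2 : |√x - 1| ≤ √(logGap x) := Real.abs_le_sqrt hg
  have h3 := logGap_nonneg hx
  rw [abs_le] at h2 ⊢
  constructor
  · rcases le_total 1 √x with h | h
    · have : 0 ≤ Real.log x := by
        rw [hlog]
        have := Real.log_nonneg h
        linarith
      linarith [Real.sqrt_nonneg (logGap x)]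
    · have : -Real.log x = logGap x + (1 - √x) * (1 + √x) := by
        unfold logGap
        linear_combination hsq
      nlinarith
  · linarith

/-- Perturbing every term of a positive sum by a factor `x k` changes its logarithm by at most
the total size of the `log (x k)`. -/
lemma abs_log_sum_div_sub_log_sum_le {κ : Type*} [Fintype κ] [Nonempty κ] {b x : κ → ℝ}
    (hb : ∀ k, 0 < b k) (hx : ∀ k, 0 < x k) :
    |Real.log (∑ k, b k / x k) - Real.log (∑ k, b k)| ≤ ∑ k, |Real.log (x k)| := by
  set M := ∑ k, |Real.log (x k)| with hM
  have hMk : ∀ k, |Real.log (x k)| ≤ M := fun k =>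
    Finset.single_le_sum (f := fun k => |Real.log (x k)|) (fun k _ => abs_nonneg _)
      (Finset.mem_univ k)
  have hpos : 0 < ∑ k, b k := Finset.sum_pos (fun k _ => hb k) Finset.univ_nonempty
  have hpos' : 0 < ∑ k, b k / x k :=
    Finset.sum_pos (fun k _ => div_pos (hb k) (hx k)) Finset.univ_nonempty
  have hup : ∑ k, b k / x k ≤ (∑ k, b k) * Real.exp M := by
    rw [Finset.sum_mul]
    refine Finset.sum_le_sum fun k _ => ?_
    rw [div_eq_mul_inv]
    refine mul_le_mul_of_nonneg_left ?_ (hb k).le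
    rw [← Real.log_le_iff_le_exp (inv_pos.2 (hx k)), Real.log_inv]
    exact (neg_le_abs _).trans (hMk k)
  have hlow : (∑ k, b k) * Real.exp (-M) ≤ ∑ k, b k / x k := by
    rw [Finset.sum_mul]
    refine Finset.sum_le_sum fun k _ => ?_
    rw [div_eq_mul_inv]
    refine mul_le_mul_of_nonneg_left ?_ (hb k).le
    rw [← Real.le_log_iff_exp_le (inv_pos.2 (hx k)), Real.log_inv]
    exact neg_le_neg ((le_abs_self _).trans (hMk k))
  have h1 := Real.log_le_log hpos' hup
  have h2 := Real.log_le_log (mul_pos hpos (Real.exp_pos _)) hlow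
  rw [Real.log_mul hpos.ne' (Real.exp_pos _).ne', Real.log_exp] at h1 h2
  rw [abs_le]
  constructor <;> linarith

/-- Cauchy–Schwarz on a tail of small sum; the finitely many earlier terms are negligible against
`√n`. -/
lemma tendsto_sum_sqrt_div_sqrt {a : ℕ → ℝ} (ha : ∀ i, 0 ≤ a i) (hs : Summable a) :
    Tendsto (fun n : ℕ => (∑ i ∈ Finset.range n, √(a i)) / √n) atTop (𝓝 0) := by
  have hsqrt : Tendsto (fun n : ℕ => √(n : ℝ)) atTop atTop :=
    Real.tendsto_sqrt_atTop.comp tendsto_natCast_atTop_atTop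
  rw [Metric.tendsto_atTop']
  intro ε hε
  have htail := tendsto_sum_nat_add a
  obtain ⟨N, hN⟩ := (htail.eventually_lt_const (show (0 : ℝ) < (ε / 2) ^ 2 by positivity)).exists
  set C := ∑ i ∈ Finset.range N, √(a i) with hC
  have hC0 : 0 ≤ C := Finset.sum_nonneg fun i _ => Real.sqrt_nonneg _
  obtain ⟨n₀, hn₀⟩ := eventually_atTop.1 (hsqrt.eventually_gt_atTop (2 * C / ε))
  refine ⟨n₀ + N, fun n hn => ?_⟩
  have hn1 := hn₀ n (by omega)
  have hnpos : 0 < √(n : ℝ) := lt_of_le_of_lt (by positivity) hn1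
  rw [Real.dist_eq, sub_zero, abs_of_nonneg
    (div_nonneg (Finset.sum_nonneg fun i _ => Real.sqrt_nonneg _) hnpos.le), div_lt_iff₀ hnpos]
  obtain ⟨m, rfl⟩ : ∃ m, n = N + m := ⟨n - N, by omega⟩
  rw [Finset.sum_range_add, ← hC]
  have hcs : ∑ i ∈ Finset.range m, √(a (N + i)) ≤ √((N + m : ℕ) : ℝ) * (ε / 2) := by
    refine le_of_sq_le_sq ?_ (by positivity)
    have h1 := sq_sum_le_card_mul_sum_sq (s := Finset.range m) (f := fun i => √(a (N + i)))
    refine h1.trans ?_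
    rw [mul_pow, Real.sq_sqrt (by positivity), Finset.card_range]
    have hle : ∑ i ∈ Finset.range m, √(a (N + i)) ^ 2 ≤ (ε / 2) ^ 2 := by
      refine le_trans ?_ hN.le
      have hs' : Summable fun i => a (i + N) := (summable_nat_add_iff N).2 hs
      refine le_trans (le_of_eq ?_) (hs'.sum_le_tsum (Finset.range m) fun i _ => ha _)
      refine Finset.sum_congr rfl fun i _ => ?_
      rw [Real.sq_sqrt (ha _), add_comm]
    refine mul_le_mul ?_ hle (Finset.sum_nonneg fun i _ => sq_nonneg _) (by positivity)
    push_cast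
    linarith [(Nat.cast_nonneg N : (0 : ℝ) ≤ N)]
  rw [div_lt_iff₀ hε] at hn1
  linarith

lemma univ_nonempty_of_sum_eq_one {κ : Type*} [Fintype κ] {w : κ → ℝ} (hw1 : ∑ k, w k = 1) :
    (Finset.univ : Finset κ).Nonempty := by
  by_contra h
  rw [Finset.not_nonempty_iff_eq_empty.1 h] at hw1
  simp at hw1

/-! ### The recursion along a data sequence -/

section Path

variable {κ Θ : Type*} [Fintype κ] [Fintype Θ] {X : κ → Type*}
  {L : (k : κ) → Θ → X k → ℝ} {w : κ → ℝ} {μ₀ : Θ → ℝ} {x : ℕ → (k : κ) → X k}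

/-- The predictive density of the observation of agent `k`, relative to its density under `θ₀`. -/
noncomputable def evidenceRatio (L : (k : κ) → Θ → X k → ℝ) (w : κ → ℝ) (μ₀ : Θ → ℝ) (θ₀ : Θ)
    (x : ℕ → (k : κ) → X k) (i : ℕ) (k : κ) : ℝ :=
  (∑ θ', L k θ' (x i k) * belief L w μ₀ x i θ') / L k θ₀ (x i k)

lemma belief_nonneg (hL : ∀ k θ x, 0 ≤ L k θ x) (hw : ∀ k, 0 ≤ w k) (hμ₀ : ∀ θ, 0 ≤ μ₀ θ)
    (i : ℕ) (θ : Θ) : 0 ≤ belief L w μ₀ x i θ := by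
  induction i generalizing θ with
  | zero => exact hμ₀ θ
  | succ i ih =>
    exact Finset.sum_nonneg fun k _ => mul_nonneg (hw k)
      (div_nonneg (mul_nonneg (hL _ _ _) (ih θ))
        (Finset.sum_nonneg fun θ' _ => mul_nonneg (hL _ _ _) (ih θ')))

/-- Mass can be lost: when a normalizer vanishes, division by zero makes that agent's belief zero.
-/
lemma sum_belief_le_one (hw : ∀ k, 0 ≤ w k) (hw1 : ∑ k, w k = 1) (hμ₀ : ∑ θ, μ₀ θ = 1) (i : ℕ) :
    ∑ θ, belief L w μ₀ x i θ ≤ 1 := by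
  cases i with
  | zero => exact hμ₀.le
  | succ i =>
    simp only [belief, fuse, adapt]
    rw [Finset.sum_comm, ← hw1]
    refine Finset.sum_le_sum fun k _ => ?_
    rw [← Finset.mul_sum, ← Finset.sum_div]
    exact mul_le_of_le_one_right (hw k) (div_self_le_one _)

lemma belief_congr {y : ℕ → (k : κ) → X k} {i : ℕ} (h : ∀ j < i, x j = y j) :
    belief L w μ₀ x i = belief L w μ₀ y i := by
  induction i with
  | zero => rfl
  | succ i ih =>
    simp only [belief]
    rw [ih fun j hj => h j (by omega), h i (by omega)]

/-- The domain `Z` is kept general so that the lemma also applies on the finite product of past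
observations. -/
lemma measurable_belief {Z : Type*} [MeasurableSpace Z] [∀ k, MeasurableSpace (X k)]
    (hL : ∀ k θ, Measurable (L k θ)) {ξ : ℕ → Z → (k : κ) → X k} (hξ : ∀ i, Measurable (ξ i))
    (i : ℕ) (θ : Θ) : Measurable fun z => belief L w μ₀ (fun j => ξ j z) i θ := by
  induction i generalizing θ with
  | zero => exact measurable_const
  | succ i ih =>
    have hLξ : ∀ k θ', Measurable fun z => L k θ' (ξ i z k) := fun k θ' =>
      (hL k θ').comp ((measurable_pi_apply k).comp (hξ i))
    exact Finset.measurable_fun_sum _ fun k _ => Measurable.const_mul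
      (((hLξ k θ).mul (ih θ)).div (Finset.measurable_fun_sum _ fun θ' _ =>
        (hLξ k θ').mul (ih θ'))) _

lemma measurable_evidenceRatio {Z : Type*} [MeasurableSpace Z] [∀ k, MeasurableSpace (X k)]
    (hL : ∀ k θ, Measurable (L k θ)) {ξ : ℕ → Z → (k : κ) → X k} (hξ : ∀ i, Measurable (ξ i))
    (θ₀ : Θ) (i : ℕ) (k : κ) :
    Measurable fun z => evidenceRatio L w μ₀ θ₀ (fun j => ξ j z) i k := by
  have hLξ : ∀ k θ', Measurable fun z => L k θ' (ξ i z k) := fun k θ' =>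
    (hL k θ').comp ((measurable_pi_apply k).comp (hξ i))
  exact (Finset.measurable_fun_sum _ fun θ' _ =>
    (hLξ k θ').mul (measurable_belief hL hξ i θ')).div (hLξ k θ₀)

variable {θ₀ : Θ}

lemma belief_succ (hL₀ : ∀ i k, 0 < L k θ₀ (x i k)) (i : ℕ) (θ : Θ) :
    belief L w μ₀ x (i + 1) θ = belief L w μ₀ x i θ *
      ∑ k, w k * (L k θ (x i k) / L k θ₀ (x i k)) / evidenceRatio L w μ₀ θ₀ x i k := by
  simp only [belief, fuse, adapt, evidenceRatio]
  rw [Finset.mul_sum]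
  refine Finset.sum_congr rfl fun k _ => ?_
  have := (hL₀ i k).ne'
  field_simp

variable (hL : ∀ k θ x, 0 ≤ L k θ x) (hw : ∀ k, 0 < w k) (hw1 : ∑ k, w k = 1)
  (hμ₀ : μ₀ ∈ stdSimplex ℝ Θ) (hL₀ : ∀ i k, 0 < L k θ₀ (x i k)) (hμ₀_true : 0 < μ₀ θ₀)

include hL hw hμ₀ hL₀ in
lemma evidenceRatio_pos_of_belief_pos {i : ℕ} (hpos : 0 < belief L w μ₀ x i θ₀) (k : κ) :
    0 < evidenceRatio L w μ₀ θ₀ x i k := by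
  refine div_pos (Finset.sum_pos' (fun θ' _ => mul_nonneg (hL _ _ _)
    (belief_nonneg hL (fun k => (hw k).le) hμ₀.1 i θ')) ⟨θ₀, Finset.mem_univ _, ?_⟩) (hL₀ i k)
  exact mul_pos (hL₀ i k) hpos

include hL hw hw1 hμ₀ hL₀ hμ₀_true in
lemma belief_pos_and_evidenceRatio_pos (i : ℕ) :
    0 < belief L w μ₀ x i θ₀ ∧ ∀ k, 0 < evidenceRatio L w μ₀ θ₀ x i k := by
  have hne := univ_nonempty_of_sum_eq_one hw1
  suffices h : 0 < belief L w μ₀ x i θ₀ from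
    ⟨h, evidenceRatio_pos_of_belief_pos hL hw hμ₀ hL₀ h⟩
  induction i with
  | zero => exact hμ₀_true
  | succ i ih =>
    rw [belief_succ hL₀]
    exact mul_pos ih (Finset.sum_pos (fun k _ => div_pos
      (mul_pos (hw k) (div_pos (hL₀ i k) (hL₀ i k)))
      (evidenceRatio_pos_of_belief_pos hL hw hμ₀ hL₀ ih k)) hne)

include hL hw hw1 hμ₀ hL₀ hμ₀_true in
lemma belief_pos {θ : Θ} (hLθ : ∀ i k, 0 < L k θ (x i k)) (hμ₀_wrong : 0 < μ₀ θ) (i : ℕ) :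
    0 < belief L w μ₀ x i θ := by
  have hne := univ_nonempty_of_sum_eq_one hw1
  induction i with
  | zero => exact hμ₀_wrong
  | succ i ih =>
    rw [belief_succ hL₀]
    exact mul_pos ih (Finset.sum_pos (fun k _ => div_pos
      (mul_pos (hw k) (div_pos (hLθ i k) (hL₀ i k)))
      ((belief_pos_and_evidenceRatio_pos hL hw hw1 hμ₀ hL₀ hμ₀_true i).2 k)) hne)

include hL hw hw1 hμ₀ hL₀ hμ₀_true in
-- Telescoping `log μ_n(θ₀)` and applying Jensen to the logarithm at each step. The linear terms `e
-- k` stay on the right, to be bounded in expectation.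
lemma sum_logGap_evidenceRatio_le (n : ℕ) :
    ∑ i ∈ Finset.range n, ∑ k, w k * logGap (evidenceRatio L w μ₀ θ₀ x i k) + n ≤
      ∑ i ∈ Finset.range n, ∑ k, w k * evidenceRatio L w μ₀ θ₀ x i k - Real.log (μ₀ θ₀) := by
  have hpos := belief_pos_and_evidenceRatio_pos hL hw hw1 hμ₀ hL₀ hμ₀_true
  -- The term `log μ_n(θ₀) ≤ 0` is kept to make the induction telescope, then dropped.
  suffices h : ∀ n : ℕ,
      ∑ i ∈ Finset.range n, ∑ k, w k * logGap (evidenceRatio L w μ₀ θ₀ x i k) + n ≤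
        ∑ i ∈ Finset.range n, ∑ k, w k * evidenceRatio L w μ₀ θ₀ x i k - Real.log (μ₀ θ₀)
          + Real.log (belief L w μ₀ x n θ₀) by
    have hle : belief L w μ₀ x n θ₀ ≤ 1 :=
      (Finset.single_le_sum (f := belief L w μ₀ x n)
        (fun θ' _ => belief_nonneg hL (fun k => (hw k).le) hμ₀.1 n θ')
        (Finset.mem_univ θ₀)).trans (sum_belief_le_one (fun k => (hw k).le) hw1 hμ₀.2 n)
    linarith [h n, Real.log_nonpos (hpos n).1.le hle]
  intro n
  induction n with
  | zero => simp [belief]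
  | succ n ih =>
    obtain ⟨hb, he⟩ := hpos n
    rw [Finset.sum_range_succ, Finset.sum_range_succ, belief_succ hL₀]
    have hsimp : ∀ k, w k * (L k θ₀ (x n k) / L k θ₀ (x n k)) / evidenceRatio L w μ₀ θ₀ x n k
        = w k * (evidenceRatio L w μ₀ θ₀ x n k)⁻¹ := fun k => by
      rw [div_self (hL₀ n k).ne', mul_one, div_eq_mul_inv]
    simp_rw [hsimp]
    have hspos : 0 < ∑ k, w k * (evidenceRatio L w μ₀ θ₀ x n k)⁻¹ :=
      Finset.sum_pos (fun k _ => mul_pos (hw k) (inv_pos.2 (he k)))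
        (univ_nonempty_of_sum_eq_one hw1)
    rw [Real.log_mul hb.ne' hspos.ne']
    have hj := strictConcaveOn_log_Ioi.concaveOn.le_map_sum (t := Finset.univ) (w := w)
      (p := fun k => (evidenceRatio L w μ₀ θ₀ x n k)⁻¹) (fun k _ => (hw k).le) hw1
      (fun k _ => inv_pos.2 (he k))
    simp only [smul_eq_mul, Real.log_inv] at hj
    have hgap : ∑ k, w k * logGap (evidenceRatio L w μ₀ θ₀ x n k)
        = ∑ k, w k * evidenceRatio L w μ₀ θ₀ x n k - 1
          + ∑ k, w k * -Real.log (evidenceRatio L w μ₀ θ₀ x n k) := by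
      rw [← hw1, ← Finset.sum_sub_distrib, ← Finset.sum_add_distrib]
      exact Finset.sum_congr rfl fun k _ => by unfold logGap; ring
    push_cast
    linarith

include hL hw hw1 hμ₀ hL₀ hμ₀_true in
-- The factor 2 counts one perturbation for `θ` and one for `θ₀`, whose unperturbed sum is 1.
lemma abs_logBeliefRatio_succ_le {θ : Θ} (hLθ : ∀ i k, 0 < L k θ (x i k)) (hμ₀_wrong : 0 < μ₀ θ)
    (i : ℕ) :
    |logBeliefRatio L w μ₀ θ₀ θ x (i + 1) - logBeliefRatio L w μ₀ θ₀ θ x i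
        + logAvgRatio L w θ₀ θ (x i)| ≤
      2 * ∑ k, |Real.log (evidenceRatio L w μ₀ θ₀ x i k)| := by
  have hne := univ_nonempty_of_sum_eq_one hw1
  have : Nonempty κ := Finset.univ_nonempty_iff.1 hne
  obtain ⟨hb, he⟩ := belief_pos_and_evidenceRatio_pos hL hw hw1 hμ₀ hL₀ hμ₀_true i
  have hbθ := belief_pos hL hw hw1 hμ₀ hL₀ hμ₀_true hLθ hμ₀_wrong i
  have hc : ∀ θ', (∀ i k, 0 < L k θ' (x i k)) →
      ∀ k, 0 < w k * (L k θ' (x i k) / L k θ₀ (x i k)) := fun θ' h k =>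
    mul_pos (hw k) (div_pos (h i k) (hL₀ i k))
  have hs : ∀ θ', (∀ i k, 0 < L k θ' (x i k)) → 0 < ∑ k,
      w k * (L k θ' (x i k) / L k θ₀ (x i k)) / evidenceRatio L w μ₀ θ₀ x i k := fun θ' h =>
    Finset.sum_pos (fun k _ => div_pos (hc θ' h k) (he k)) hne
  have h₀ := abs_log_sum_div_sub_log_sum_le (hc θ₀ hL₀) he
  have h₁ := abs_log_sum_div_sub_log_sum_le (hc θ hLθ) he
  have hone : ∑ k, w k * (L k θ₀ (x i k) / L k θ₀ (x i k)) = 1 := by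
    rw [← hw1]
    exact Finset.sum_congr rfl fun k _ => by rw [div_self (hL₀ i k).ne', mul_one]
  rw [hone, Real.log_one] at h₀
  unfold logBeliefRatio logAvgRatio
  rw [belief_succ hL₀, belief_succ hL₀,
    Real.log_div (mul_pos hb (hs θ₀ hL₀)).ne' (mul_pos hbθ (hs θ hLθ)).ne',
    Real.log_mul hb.ne' (hs θ₀ hL₀).ne', Real.log_mul hbθ.ne' (hs θ hLθ).ne',
    Real.log_div hb.ne' hbθ.ne']
  rw [abs_le] at h₀ h₁ ⊢
  constructor <;> linarith [h₀.1, h₀.2, h₁.1, h₁.2]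

include hL hw hw1 hμ₀ hL₀ hμ₀_true in
lemma tendsto_logBeliefRatio_add_sum_div_sqrt {θ : Θ} (hLθ : ∀ i k, 0 < L k θ (x i k))
    (hμ₀_wrong : 0 < μ₀ θ)
    (hsum : Summable fun i => ∑ k, w k * logGap (evidenceRatio L w μ₀ θ₀ x i k)) :
    Tendsto (fun n : ℕ => (logBeliefRatio L w μ₀ θ₀ θ x n
      + ∑ i ∈ Finset.range n, logAvgRatio L w θ₀ θ (x i)) / √n) atTop (𝓝 0) := by
  have hpos := fun i => (belief_pos_and_evidenceRatio_pos hL hw hw1 hμ₀ hL₀ hμ₀_true i).2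
  have hg0 : ∀ i k, 0 ≤ logGap (evidenceRatio L w μ₀ θ₀ x i k) := fun i k =>
    logGap_nonneg (hpos i k)
  have hgs : ∀ k, Summable fun i => logGap (evidenceRatio L w μ₀ θ₀ x i k) := fun k => by
    have : Summable fun i => w k * logGap (evidenceRatio L w μ₀ θ₀ x i k) :=
      hsum.of_nonneg_of_le (fun i => mul_nonneg (hw k).le (hg0 i k)) fun i =>
        Finset.single_le_sum (f := fun k => w k * logGap (evidenceRatio L w μ₀ θ₀ x i k))
          (fun k _ => mul_nonneg (hw k).le (hg0 i k)) (Finset.mem_univ k)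
    exact (summable_mul_left_iff (hw k).ne').1 this
  have hsqrt : Tendsto (fun n : ℕ => √(n : ℝ)) atTop atTop :=
    Real.tendsto_sqrt_atTop.comp tendsto_natCast_atTop_atTop
  have hbound : ∀ n : ℕ, |logBeliefRatio L w μ₀ θ₀ θ x n
      + ∑ i ∈ Finset.range n, logAvgRatio L w θ₀ θ (x i)| ≤
      |logBeliefRatio L w μ₀ θ₀ θ x 0| + 2 * ∑ k,
        (∑' i, logGap (evidenceRatio L w μ₀ θ₀ x i k)
          + 2 * ∑ i ∈ Finset.range n, √(logGap (evidenceRatio L w μ₀ θ₀ x i k))) := by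
    intro n
    have hstep : |logBeliefRatio L w μ₀ θ₀ θ x n
        + ∑ i ∈ Finset.range n, logAvgRatio L w θ₀ θ (x i)| ≤
        |logBeliefRatio L w μ₀ θ₀ θ x 0| + 2 * ∑ i ∈ Finset.range n, ∑ k,
          |Real.log (evidenceRatio L w μ₀ θ₀ x i k)| := by
      induction n with
      | zero => simp
      | succ n ih =>
        have h := abs_logBeliefRatio_succ_le hL hw hw1 hμ₀ hL₀ hμ₀_true hLθ hμ₀_wrong n
        rw [Finset.sum_range_succ, Finset.sum_range_succ]
        refine le_trans (le_of_eq ?_) ((abs_add_le _ _).trans (add_le_add ih h)) |>.trans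
          (le_of_eq ?_)
        · congr 1; ring
        · ring
    refine hstep.trans ?_
    rw [Finset.sum_comm]
    gcongr with k
    calc ∑ i ∈ Finset.range n, |Real.log (evidenceRatio L w μ₀ θ₀ x i k)|
        ≤ ∑ i ∈ Finset.range n, (logGap (evidenceRatio L w μ₀ θ₀ x i k)
            + 2 * √(logGap (evidenceRatio L w μ₀ θ₀ x i k))) :=
          Finset.sum_le_sum fun i _ => abs_log_le_logGap (hpos i k)
      _ ≤ _ := by
          rw [Finset.sum_add_distrib, ← Finset.mul_sum]
          gcongr
          exact (hgs k).sum_le_tsum _ fun i _ => hg0 i k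
  have hlim : Tendsto (fun n : ℕ => |logBeliefRatio L w μ₀ θ₀ θ x 0| / √n + 2 * ∑ k,
        ((∑' i, logGap (evidenceRatio L w μ₀ θ₀ x i k)) / √n
          + 2 * ((∑ i ∈ Finset.range n, √(logGap (evidenceRatio L w μ₀ θ₀ x i k))) / √n)))
      atTop (𝓝 (0 + 2 * ∑ _k : κ, (0 + 2 * 0))) :=
    (hsqrt.const_div_atTop _).add ((tendsto_finsetSum _ fun k _ =>
      (hsqrt.const_div_atTop _).add
        ((tendsto_sum_sqrt_div_sqrt (fun i => hg0 i k) (hgs k)).const_mul 2)).const_mul 2)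
  have hz : (0 + 2 * ∑ _k : κ, (0 + 2 * 0) : ℝ) = 0 := by simp
  rw [hz] at hlim
  refine squeeze_zero_norm (fun n => ?_) hlim
  rw [Real.norm_eq_abs, abs_div, abs_of_nonneg (Real.sqrt_nonneg _)]
  refine (div_le_div_of_nonneg_right (hbound n) (Real.sqrt_nonneg _)).trans (le_of_eq ?_)
  rw [add_div, mul_div_assoc, Finset.sum_div]
  simp_rw [add_div, mul_div_assoc]

end Path

/-! ### Likelihood ratios under the true hypothesis -/

section Law

variable {X : Type*} [MeasurableSpace X] {ν : Measure X} {f g : X → ℝ}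

lemma ae_law_pos (hf : Measurable f) : ∀ᵐ x ∂law ν f, 0 < f x := by
  unfold law
  rw [ae_withDensity_iff hf.ennreal_ofReal]
  filter_upwards with x hx
  exact ENNReal.ofReal_pos.1 (pos_iff_ne_zero.2 hx)

/-- The density `f` cancels where it is positive; any mass of `g` elsewhere is lost, hence only `≤`.
-/
lemma lintegral_div_law_le (hf : Measurable f) (hg : Measurable g)
    [IsProbabilityMeasure (law ν g)] :
    ∫⁻ x, ENNReal.ofReal (g x / f x) ∂law ν f ≤ 1 := by
  have h1 : ∫⁻ x, ENNReal.ofReal (g x) ∂ν = 1 := by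
    have := measure_univ (μ := law ν g)
    rwa [law, withDensity_apply _ MeasurableSet.univ, setLIntegral_univ] at this
  rw [← h1, law, lintegral_withDensity_eq_lintegral_mul _ hf.ennreal_ofReal
    (show Measurable fun x => ENNReal.ofReal (g x / f x) from (hg.div hf).ennreal_ofReal)]
  refine lintegral_mono fun x => ?_
  rcases le_or_gt (f x) 0 with h | h
  · simp [ENNReal.ofReal_of_nonpos h]
  · rw [Pi.mul_apply, ← ENNReal.ofReal_mul h.le, mul_div_cancel₀ _ h.ne']

end Law

/-! ### The belief recursion along random data -/

section Random

variable {κ Θ Ω : Type*} [Fintype κ] [Fintype Θ] [MeasurableSpace Ω]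
  {P : Measure Ω} [IsProbabilityMeasure P] {X : κ → Type*} [∀ k, MeasurableSpace (X k)]
  {L : (k : κ) → Θ → X k → ℝ} {w : κ → ℝ} {μ₀ : Θ → ℝ} {ξ : ℕ → Ω → (k : κ) → X k}

/-- The belief at index `i` is a function of the observations before `i` only. -/
lemma indepFun_belief_observation (hL : ∀ k θ, Measurable (L k θ)) (hξ : ∀ i, Measurable (ξ i))
    (hind : iIndepFun ξ P) (i : ℕ) (θ : Θ) :
    IndepFun (fun ω => belief L w μ₀ (fun j => ξ j ω) i θ) (ξ i) P := by
  obtain ⟨ω₀⟩ : Nonempty Ω := nonempty_of_isProbabilityMeasure P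
  classical
  have h := hind.indepFun_finset (Finset.range i) {i} (by simp) hξ
  -- The filler `ξ 0 ω₀` is arbitrary: by `belief_congr`, entries from `i` on do not matter.
  set ext : ℕ → (Finset.range i → (k : κ) → X k) → (k : κ) → X k :=
    fun j z => if hj : j ∈ Finset.range i then z ⟨j, hj⟩ else ξ 0 ω₀ with hext
  have hm : ∀ j, Measurable (ext j) := fun j => by
    by_cases hj : j ∈ Finset.range i
    · simp only [hext, hj, dite_true]
      exact measurable_pi_apply _
    · simp only [hext, hj, dite_false]
      exact measurable_const
  have h2 := h.comp (measurable_belief (w := w) (μ₀ := μ₀) hL hm i θ)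
    (measurable_pi_apply (⟨i, by simp⟩ : ({i} : Finset ℕ)))
  refine h2.congr (.of_forall fun ω => ?_) (.of_forall fun ω => rfl)
  refine congrFun (belief_congr fun j hj => ?_) θ
  simp [hext, hj]

variable {ν : (k : κ) → Measure (X k)} {θ₀ : Θ}

/-- The evidence ratio mixes likelihood ratios of mean at most 1, with weights of total mass at most
1 that are independent of the current observation. -/
lemma lintegral_evidenceRatio_le_one (hL_meas : ∀ k θ, Measurable (L k θ))
    (hL : ∀ k θ x, 0 ≤ L k θ x) (hL_prob : ∀ k θ, IsProbabilityMeasure (law (ν k) (L k θ)))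
    (hw : ∀ k, 0 ≤ w k) (hw1 : ∑ k, w k = 1) (hμ₀ : μ₀ ∈ stdSimplex ℝ Θ)
    (hξ : ∀ i, Measurable (ξ i)) (hind : iIndepFun ξ P)
    (hlaw : ∀ i k, P.map (fun ω => ξ i ω k) = law (ν k) (L k θ₀)) (i : ℕ) (k : κ) :
    ∫⁻ ω, ENNReal.ofReal (evidenceRatio L w μ₀ θ₀ (fun j => ξ j ω) i k) ∂P ≤ 1 := by
  have hb0 : ∀ ω θ', 0 ≤ belief L w μ₀ (fun j => ξ j ω) i θ' := fun ω =>
    belief_nonneg hL hw hμ₀.1 i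
  have hbm : ∀ θ', Measurable fun ω => belief L w μ₀ (fun j => ξ j ω) i θ' :=
    measurable_belief hL_meas hξ i
  have hξk : Measurable fun ω => ξ i ω k := (measurable_pi_apply k).comp (hξ i)
  have hrξ : ∀ θ', Measurable fun ω => ENNReal.ofReal (L k θ' (ξ i ω k) / L k θ₀ (ξ i ω k)) :=
    fun θ' => (((hL_meas k θ').div (hL_meas k θ₀)).comp hξk).ennreal_ofReal
  have hrm : ∀ θ', Measurable fun y : X k => ENNReal.ofReal (L k θ' y / L k θ₀ y) := fun θ' =>
    ((hL_meas k θ').div (hL_meas k θ₀)).ennreal_ofReal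
  have heq : ∀ ω, ENNReal.ofReal (evidenceRatio L w μ₀ θ₀ (fun j => ξ j ω) i k) =
      ∑ θ', ENNReal.ofReal (belief L w μ₀ (fun j => ξ j ω) i θ')
        * ENNReal.ofReal (L k θ' (ξ i ω k) / L k θ₀ (ξ i ω k)) := fun ω => by
    rw [evidenceRatio, Finset.sum_div, ENNReal.ofReal_sum_of_nonneg fun θ' _ =>
      div_nonneg (mul_nonneg (hL _ _ _) (hb0 ω θ')) (hL _ _ _)]
    refine Finset.sum_congr rfl fun θ' _ => ?_
    rw [← ENNReal.ofReal_mul (hb0 ω θ')]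
    congr 1
    ring
  have hm : ∀ θ', Measurable fun ω => ENNReal.ofReal (belief L w μ₀ (fun j => ξ j ω) i θ')
      * ENNReal.ofReal (L k θ' (ξ i ω k) / L k θ₀ (ξ i ω k)) := fun θ' =>
    (hbm θ').ennreal_ofReal.mul (hrξ θ')
  simp_rw [heq]
  rw [lintegral_finsetSum _ fun θ' _ => hm θ']
  calc _ ≤ ∑ θ', ∫⁻ ω, ENNReal.ofReal (belief L w μ₀ (fun j => ξ j ω) i θ') ∂P := by
        refine Finset.sum_le_sum fun θ' _ => ?_
        have hI := (indepFun_belief_observation (w := w) (μ₀ := μ₀) hL_meas hξ hind i θ').comp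
          ENNReal.measurable_ofReal ((hrm θ').comp (measurable_pi_apply k))
        refine (lintegral_mul_eq_lintegral_mul_lintegral_of_indepFun
          (hbm θ').ennreal_ofReal (hrξ θ') hI).le.trans ?_
        refine mul_le_of_le_one_right zero_le ?_
        have := hL_prob k θ'
        refine le_trans (le_of_eq ?_) (lintegral_div_law_le (ν := ν k) (hL_meas k θ₀)
          (hL_meas k θ'))
        rw [← hlaw i k, lintegral_map (hrm θ') hξk]
    _ = ∫⁻ ω, ∑ θ', ENNReal.ofReal (belief L w μ₀ (fun j => ξ j ω) i θ') ∂P :=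
        (lintegral_finsetSum _ fun θ' _ => (hbm θ').ennreal_ofReal).symm
    _ ≤ ∫⁻ _, 1 ∂P := by
        refine lintegral_mono fun ω => ?_
        rw [← ENNReal.ofReal_sum_of_nonneg fun θ' _ => hb0 ω θ', ← ENNReal.ofReal_one]
        exact ENNReal.ofReal_le_ofReal (sum_belief_le_one hw hw1 hμ₀.2 i)
    _ = 1 := by simp

lemma ae_summable_logGap_evidenceRatio (hL_meas : ∀ k θ, Measurable (L k θ))
    (hL : ∀ k θ x, 0 ≤ L k θ x) (hL_prob : ∀ k θ, IsProbabilityMeasure (law (ν k) (L k θ)))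
    (hw : ∀ k, 0 < w k) (hw1 : ∑ k, w k = 1) (hμ₀ : μ₀ ∈ stdSimplex ℝ Θ) (hμ₀_true : 0 < μ₀ θ₀)
    (hξ : ∀ i, Measurable (ξ i)) (hind : iIndepFun ξ P)
    (hlaw : ∀ i k, P.map (fun ω => ξ i ω k) = law (ν k) (L k θ₀))
    (hL₀ : ∀ᵐ ω ∂P, ∀ i k, 0 < L k θ₀ (ξ i ω k)) :
    ∀ᵐ ω ∂P, Summable fun i =>
      ∑ k, w k * logGap (evidenceRatio L w μ₀ θ₀ (fun j => ξ j ω) i k) := by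
  set e : ℕ → κ → Ω → ℝ := fun i k ω => evidenceRatio L w μ₀ θ₀ (fun j => ξ j ω) i k with he
  have hem : ∀ i k, Measurable (e i k) := fun i k => measurable_evidenceRatio hL_meas hξ θ₀ i k
  have hgm : ∀ i, Measurable fun ω => ∑ k, w k * logGap (e i k ω) := fun i =>
    Finset.measurable_fun_sum _ fun k _ =>
      (((hem i k).sub_const 1).sub (Real.measurable_log.comp (hem i k))).const_mul _
  have hpos : ∀ᵐ ω ∂P, ∀ i k, 0 < e i k ω := by
    filter_upwards [hL₀] with ω hω i
    exact (belief_pos_and_evidenceRatio_pos hL hw hw1 hμ₀ hω hμ₀_true i).2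
  have he0 : ∀ i k ω, 0 ≤ e i k ω := fun i k ω =>
    div_nonneg (Finset.sum_nonneg fun θ' _ => mul_nonneg (hL _ _ _)
      (belief_nonneg hL (fun k => (hw k).le) hμ₀.1 i θ')) (hL _ _ _)
  have hone : ∀ i, ∫⁻ ω, ENNReal.ofReal (∑ k, w k * e i k ω) ∂P ≤ 1 := fun i => by
    have : ∀ ω, ENNReal.ofReal (∑ k, w k * e i k ω)
        = ∑ k, ENNReal.ofReal (w k) * ENNReal.ofReal (e i k ω) := fun ω => by
      rw [ENNReal.ofReal_sum_of_nonneg fun k _ => mul_nonneg (hw k).le (he0 i k ω)]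
      exact Finset.sum_congr rfl fun k _ => ENNReal.ofReal_mul (hw k).le
    simp_rw [this]
    rw [lintegral_finsetSum _ fun k _ => (hem i k).ennreal_ofReal.const_mul _]
    calc _ ≤ ∑ k, ENNReal.ofReal (w k) := Finset.sum_le_sum fun k _ => by
          rw [lintegral_const_mul _ (hem i k).ennreal_ofReal]
          exact mul_le_of_le_one_right zero_le (lintegral_evidenceRatio_le_one hL_meas hL
            hL_prob (fun k => (hw k).le) hw1 hμ₀ hξ hind hlaw i k)
      _ = 1 := by
          rw [← ENNReal.ofReal_sum_of_nonneg fun k _ => (hw k).le, hw1, ENNReal.ofReal_one]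
  have hg0 : ∀ᵐ ω ∂P, ∀ i, 0 ≤ ∑ k, w k * logGap (e i k ω) := by
    filter_upwards [hpos] with ω hω i
    exact Finset.sum_nonneg fun k _ => mul_nonneg (hw k).le (logGap_nonneg (hω i k))
  have hC : 0 ≤ -Real.log (μ₀ θ₀) := by
    have : μ₀ θ₀ ≤ 1 := hμ₀.2 ▸ Finset.single_le_sum (fun θ' _ => hμ₀.1 θ') (Finset.mem_univ θ₀)
    linarith [Real.log_nonpos hμ₀_true.le this]
  have hpartial : ∀ n : ℕ, ∑ i ∈ Finset.range n,
      ∫⁻ ω, ENNReal.ofReal (∑ k, w k * logGap (e i k ω)) ∂P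
        ≤ ENNReal.ofReal (-Real.log (μ₀ θ₀)) := fun n => by
    -- Adding `n` to both sides avoids truncated subtraction; it is absorbed by the `n` bounds
    -- `hone`.
    rw [← ENNReal.add_le_add_iff_right (ENNReal.natCast_ne_top n)]
    calc _ = ∫⁻ ω, (∑ i ∈ Finset.range n, ENNReal.ofReal (∑ k, w k * logGap (e i k ω)) + n) ∂P := by
          rw [lintegral_add_right _ measurable_const,
            lintegral_finsetSum _ fun i _ => (hgm i).ennreal_ofReal]
          simp
      _ ≤ ∫⁻ ω, (ENNReal.ofReal (-Real.log (μ₀ θ₀))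
            + ∑ i ∈ Finset.range n, ENNReal.ofReal (∑ k, w k * e i k ω)) ∂P := by
          refine lintegral_mono_ae ?_
          filter_upwards [hL₀, hg0] with ω hω hω0
          have hp : ∀ i, 0 ≤ ∑ k, w k * e i k ω := fun i =>
            Finset.sum_nonneg fun k _ => mul_nonneg (hw k).le (he0 i k ω)
          rw [← ENNReal.ofReal_sum_of_nonneg fun i _ => hω0 i,
            ← ENNReal.ofReal_sum_of_nonneg fun i _ => hp i, ← ENNReal.ofReal_natCast,
            ← ENNReal.ofReal_add (Finset.sum_nonneg fun i _ => hω0 i) (Nat.cast_nonneg n),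
            ← ENNReal.ofReal_add hC (Finset.sum_nonneg fun i _ => hp i)]
          refine ENNReal.ofReal_le_ofReal ?_
          have := sum_logGap_evidenceRatio_le hL hw hw1 hμ₀ hω hμ₀_true n
          simp only [he]
          linarith
      _ = ENNReal.ofReal (-Real.log (μ₀ θ₀))
            + ∑ i ∈ Finset.range n, ∫⁻ ω, ENNReal.ofReal (∑ k, w k * e i k ω) ∂P := by
          rw [lintegral_add_left measurable_const, lintegral_finsetSum _ fun i _ =>
            (Finset.measurable_fun_sum _ fun k _ => (hem i k).const_mul _).ennreal_ofReal]
          simp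
      _ ≤ _ := by
          gcongr
          refine (Finset.sum_le_sum fun i _ => hone i).trans ?_
          simp
  have htsum : ∫⁻ ω, ∑' i, ENNReal.ofReal (∑ k, w k * logGap (e i k ω)) ∂P ≠ ⊤ := by
    rw [lintegral_tsum fun i => (hgm i).ennreal_ofReal.aemeasurable]
    exact ((ENNReal.tsum_le_of_sum_range_le hpartial).trans_lt ENNReal.ofReal_lt_top).ne
  have hae := ae_lt_top (Measurable.tsum fun i => (hgm i).ennreal_ofReal) htsum
  filter_upwards [hae, hg0] with ω hω hω0
  have h := ENNReal.summable_toReal hω.ne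
  simpa only [ENNReal.toReal_ofReal (hω0 _)] using h

end Random

/-! ### Passing from convergence in distribution to distribution functions -/

/-- The frontier of `Set.Iic t` is a single point, which the Gaussian does not charge. -/
lemma tendsto_measureReal_le_of_tendstoInDistribution_gaussian {Ω : Type*} [MeasurableSpace Ω]
    {P : Measure Ω} [IsProbabilityMeasure P] {T : ℕ → Ω → ℝ}
    (hT : TendstoInDistribution T atTop id (fun _ => P) (gaussianReal 0 1)) (t : ℝ) :
    Tendsto (fun n => P.real {ω | T n ω ≤ t}) atTop (𝓝 (cdf (gaussianReal 0 1) t)) := by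
  have h := ProbabilityMeasure.tendsto_measure_of_null_frontier_of_tendsto' hT.tendsto
    (E := Set.Iic t) (by
      have := nullSingletonClass_gaussianReal (μ := 0) (v := 1) one_ne_zero
      simp)
  simp only [ProbabilityMeasure.coe_mk, Measure.map_id] at h
  rw [cdf_eq_real, measureReal_def]
  refine Tendsto.congr (fun n => ?_)
    ((ENNReal.tendsto_toReal (measure_ne_top _ _)).comp h)
  simp only [Function.comp, measureReal_def]
  rw [Measure.map_apply_of_aemeasurable (hT.forall_aemeasurable n) measurableSet_Iic]
  rfl

end FederatedAA

/-! ### The central limit theorem for the log-belief ratio -/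

theorem corollary1
    -- agents, hypotheses, sample space, observation spaces with reference measures
    {κ Θ Ω : Type*} [Fintype κ] [Fintype Θ] [MeasurableSpace Ω]
    (P : Measure Ω) [IsProbabilityMeasure P]
    {X : κ → Type*} [∀ k, MeasurableSpace (X k)]
    (ν : (k : κ) → Measure (X k)) [∀ k, SigmaFinite (ν k)]
    -- the likelihood models are probability densities
    (L : (k : κ) → Θ → X k → ℝ)
    (hL_meas : ∀ k θ, Measurable (L k θ))
    (hL_nonneg : ∀ k θ x, 0 ≤ L k θ x)
    (hL_prob : ∀ k θ, IsProbabilityMeasure (FederatedAA.law (ν k) (L k θ)))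
    -- confidence weights
    (w : κ → ℝ) (hw_pos : ∀ k, 0 < w k) (hw_sum : ∑ k, w k = 1)
    -- the true hypothesis and the wrong hypothesis under study
    (θ₀ θ : Θ) (hθ : θ ≠ θ₀)
    -- initial belief
    (μ₀ : Θ → ℝ) (hμ₀ : μ₀ ∈ stdSimplex ℝ Θ) (hμ₀_true : 0 < μ₀ θ₀) (hμ₀_wrong : 0 < μ₀ θ)
    -- observations: `ξ i` is the joint observation at time `i + 1`, i.i.d. over time,
    -- arbitrarily dependent across the agents, with marginals given by the true hypothesis
    (ξ : ℕ → Ω → (k : κ) → X k)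
    (hξ_meas : ∀ i, Measurable (ξ i))
    (hξ_indep : iIndepFun ξ P)
    (hξ_ident : ∀ i, IdentDistrib (ξ i) (ξ 0) P P)
    (hξ_law : ∀ i k, P.map (fun ω => ξ i ω k) = FederatedAA.law (ν k) (L k θ₀))
    -- each observation has finite information
    (hKL : ∀ k θ', InformationTheory.klDiv (FederatedAA.law (ν k) (L k θ₀))
      (FederatedAA.law (ν k) (L k θ')) < ⊤)
    -- global identifiability
    (hident : ∀ θ', θ' ≠ θ₀ → ∃ k, 0 < InformationTheory.klDiv
      (FederatedAA.law (ν k) (L k θ₀)) (FederatedAA.law (ν k) (L k θ')))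
    -- nonzero finite variance
    (hσ_pos : 0 < FederatedAA.sigmaSqA P L w θ₀ θ (ξ 0))
    (hσ_fin : FederatedAA.sigmaSqA P L w θ₀ θ (ξ 0) < ⊤) :
    ∀ t : ℝ, Tendsto
      (fun i : ℕ => P.real {ω |
        (FederatedAA.logBeliefRatio L w μ₀ θ₀ θ (fun j => ξ j ω) i
            - FederatedAA.rhoA P L w θ₀ θ (ξ 0) * i)
          / (FederatedAA.sigmaA P L w θ₀ θ (ξ 0) * Real.sqrt i) ≤ t})
      atTop (𝓝 (cdf (gaussianReal 0 1) t)) := by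
  -- Finite divergence gives absolute continuity, so data from `θ₀` almost surely have positive
  -- likelihood under every hypothesis.
  have hae_pos : ∀ θ', ∀ᵐ ω ∂P, ∀ i k, 0 < L k θ' (ξ i ω k) := fun θ' => by
    refine ae_all_iff.2 fun i => ae_all_iff.2 fun k => ?_
    have hξk : Measurable fun ω => ξ i ω k := (measurable_pi_apply k).comp (hξ_meas i)
    have hac := (InformationTheory.klDiv_ne_top_iff.1 (hKL k θ').ne).1
    have h := hac.ae_le (FederatedAA.ae_law_pos (ν := ν k) (hL_meas k θ'))
    rw [← hξ_law i k] at h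
    exact ae_of_ae_map hξk.aemeasurable h
  have hY_meas : Measurable (FederatedAA.logAvgRatio L w θ₀ θ) :=
    Real.measurable_log.comp (Finset.measurable_fun_sum _ fun k _ =>
      (((hL_meas k θ).comp (measurable_pi_apply k)).div
        ((hL_meas k θ₀).comp (measurable_pi_apply k))).const_mul _)
  set Y : ((k : κ) → X k) → ℝ := FederatedAA.logAvgRatio L w θ₀ θ with hY
  set σ := FederatedAA.sigmaA P L w θ₀ θ (ξ 0) with hσ
  set ρ := FederatedAA.rhoA P L w θ₀ θ (ξ 0) with hρ
  have hvar : Var[fun ω => Y (ξ 0 ω); P] = σ ^ 2 := by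
    rw [hσ, FederatedAA.sigmaA, Real.sq_sqrt ENNReal.toReal_nonneg]
    rfl
  have hσ_pos' : 0 < σ := Real.sqrt_pos.2 (ENNReal.toReal_pos hσ_pos.ne' hσ_fin.ne)
  have hmemLp : MemLp (fun ω => Y (ξ 0 ω)) 2 P :=
    (evariance_lt_top_iff_memLp (hY_meas.comp (hξ_meas 0)).aestronglyMeasurable).1 hσ_fin
  -- The scale gives unit variance; the sign reflects that the log-belief ratio follows minus the
  -- sum of `Y`.
  set g : ((k : κ) → X k) → ℝ := fun y => (-σ⁻¹) * Y y with hg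
  have hg_meas : Measurable g := hY_meas.const_mul _
  have hmean : P[fun ω => g (ξ 0 ω)] = ρ / σ := by
    simp only [hg]
    rw [integral_const_mul, hρ, FederatedAA.rhoA]
    ring
  have hvar1 : Var[fun ω => g (ξ 0 ω); P] = 1 := by
    simp only [hg]
    rw [variance_const_mul, hvar]
    field_simp
  have hclt := tendstoInDistribution_inv_sqrt_mul_sum_sub (P := P) (P' := gaussianReal 0 1)
    (X := fun i ω => g (ξ i ω)) (Y := id)
    ⟨aemeasurable_id, by rw [hvar1, Measure.map_id, Real.toNNReal_one]⟩
    (hmemLp.const_mul _) (hξ_indep.comp (fun _ => g) fun _ => hg_meas)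
    (fun i => (hξ_ident i).comp hg_meas)
  refine FederatedAA.tendsto_measureReal_le_of_tendstoInDistribution_gaussian ?_
  have hT_meas : ∀ n : ℕ, Measurable fun ω =>
      (FederatedAA.logBeliefRatio L w μ₀ θ₀ θ (fun j => ξ j ω) n - ρ * n) / (σ * √n) := fun n =>
    ((Real.measurable_log.comp ((FederatedAA.measurable_belief hL_meas hξ_meas n θ₀).div
      (FederatedAA.measurable_belief hL_meas hξ_meas n θ))).sub_const _).div_const _
  -- Slutsky: the two normalized sequences differ by `σ⁻¹` times the path error, which tends to 0
  -- almost surely.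
  refine tendstoInDistribution_of_tendstoInMeasure_sub _ _ hclt
    (tendstoInMeasure_of_tendsto_ae (fun n => ?_) ?_) fun n => (hT_meas n).aemeasurable
  · refine ((hT_meas n).sub (Measurable.const_mul ((Finset.measurable_fun_sum _ fun i _ =>
      hg_meas.comp (hξ_meas i)).sub_const _) _)).aestronglyMeasurable
  filter_upwards [hae_pos θ₀, hae_pos θ, FederatedAA.ae_summable_logGap_evidenceRatio hL_meas
    hL_nonneg hL_prob hw_pos hw_sum hμ₀ hμ₀_true hξ_meas hξ_indep hξ_law (hae_pos θ₀)]
    with ω hω₀ hωθ hωs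
  have hlim := (FederatedAA.tendsto_logBeliefRatio_add_sum_div_sqrt hL_nonneg hw_pos hw_sum hμ₀
    hω₀ hμ₀_true hωθ hμ₀_wrong hωs).const_mul σ⁻¹
  rw [mul_zero] at hlim
  refine hlim.congr fun n => ?_
  simp only [Pi.sub_apply, hmean]
  have hsum : ∑ i ∈ Finset.range n, g (ξ i ω) = -σ⁻¹ * ∑ i ∈ Finset.range n, Y (ξ i ω) := by
    rw [Finset.mul_sum]
  rw [hsum]
  rcases Nat.eq_zero_or_pos n with rfl | hn
  · simp
  have hn' : √(n : ℝ) ≠ 0 := (Real.sqrt_pos.2 (Nat.cast_pos.2 hn)).ne'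
  field_simp
  ring
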